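/- For a topological space $X$ let $\Omega X$ be the locale given by the frame of open subsets of $X$; a locale is called spatial if it is isomorphic to $\Omega X$ for some topological space $X$. Let $\oplus$ denote the product in the category of locales (the coproduct of frames). Then: 1. $\Omega\mathbb{Q}\oplus\Omega\mathbb{Q}$ is not spatial, where $\mathbb{Q}$ carries the topology inherited from $\mathbb{R}$. 2. $\Omega S\oplus\Omega S$ is not spatial, where $S$ is the Sorgenfrey line, i.e. $\mathbb{R}$ with the topology generated by the half-open intervals $[a,b)$. 3. Let $\mathrm{WF}$ be the set of wellfounded trees on $\omega$, i.e. of the sets $T\subseteq\omega^{<\omega}$ closed under initial segments such that there is no $x\in\omega^\omega$ with $x\restriction n\in T$ for all $n$, topologized as a subspace of $2^{\omega^{<\omega}}$ (with the product topology) by identifying a tree with its characteristic function. Then $\Omega(\mathrm{WF})\oplus\Omega(\omega^\omega)$ is not spatial, where $\omega^\omega$ carries the product topology of the discrete space $\omega$. 4. The uncountable localic product $\bigoplus_{i<\omega_1}\Omega(\omega)$ is not spatial, where $\omega$ is discrete. 5. If $X$ is a nonempty Hausdorff space and $A,B\subseteq X$ are disjoint dense subsets with the subspace topologies, then $\Omega(A)\oplus\Omega(B)$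 is not spatial. -/

import Mathlib

open CategoryTheory TopologicalSpace

universe u v

/-- The locale `Ω X` of open sets of a topological space `X`. -/
abbrev omegaLocale (X : Type u) [TopologicalSpace X] : Locale.{u} :=
  topToLocale.obj (TopCat.of X)

/-- A locale is spatial if it is isomorphic, in the category of locales, to `Ω X` for some
topological space `X`. -/
def Locale.IsSpatial (L : Locale.{u}) : Prop :=
  ∃ X : TopCat.{u}, Nonempty (L ≅ topToLocale.obj X)

/-! ### The product of two locales -/

/-- The underlying set of the localic product of two frames `L` and `M`: the downwards closed
`A ⊆ L × M` that are closed under arbitrary (including empty) joins in each coordinate. -/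
@[ext]
structure LocProd (L : Type u) (M : Type v) [Order.Frame L] [Order.Frame M] where
  carrier : Set (L × M)
  lower' : IsLowerSet carrier
  sSup_left' : ∀ (S : Set L) (b : M), (∀ a ∈ S, (a, b) ∈ carrier) → (sSup S, b) ∈ carrier
  sSup_right' : ∀ (a : L) (S : Set M), (∀ b ∈ S, (a, b) ∈ carrier) → (a, sSup S) ∈ carrier

namespace LocProd

variable {L : Type u} {M : Type v} [Order.Frame L] [Order.Frame M]

/-- Elements of the localic product are ordered by inclusion. -/
instance : PartialOrder (LocProd L M) :=
  PartialOrder.lift LocProd.carrier (fun _ _ h => LocProd.ext h)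

instance : InfSet (LocProd L M) where
  sInf T :=
    { carrier := {p | ∀ A ∈ T, p ∈ A.carrier}
      lower' := fun _ _ hqp hp A hA => A.lower' hqp (hp A hA)
      sSup_left' := fun S b h A hA => A.sSup_left' S b fun a ha => h a ha A hA
      sSup_right' := fun a S h A hA => A.sSup_right' a S fun b hb => h b hb A hA }

instance : CompleteLattice (LocProd L M) :=
  completeLatticeOfInf _ fun _ => ⟨fun A hA _ hp => hp A hA, fun _ hB _ hp _ hA => hB hA hp⟩

/-- The relative pseudocomplement, used to verify the infinite distributive law. -/
def residual (A B : LocProd L M) : LocProd L M where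
  carrier := {p | ∀ q ∈ A.carrier, q ⊓ p ∈ B.carrier}
  lower' := fun _ _ h hp q hq => B.lower' (inf_le_inf_left q h) (hp q hq)
  sSup_left' := by
    rintro S b h ⟨c, d⟩ hq
    have := B.sSup_left' ((fun a => c ⊓ a) '' S) (d ⊓ b) (by
      rintro _ ⟨a, ha, rfl⟩
      exact h a ha (c, d) hq)
    rwa [sSup_image, ← inf_sSup_eq] at this
  sSup_right' := by
    rintro a S h ⟨c, d⟩ hq
    have := B.sSup_right' (c ⊓ a) ((fun b => d ⊓ b) '' S) (by
      rintro _ ⟨b, hb, rfl⟩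
      exact h b hb (c, d) hq)
    rwa [sSup_image, ← inf_sSup_eq] at this

theorem inf_le_iff_le_residual (A B C : LocProd L M) : A ⊓ C ≤ B ↔ C ≤ residual A B := by
  constructor
  · intro h p hp q hq
    have h1 : sInf {A, C} ≤ B := le_trans (le_inf (sInf_le (by simp)) (sInf_le (by simp))) h
    refine h1 ?_
    rintro D (rfl | rfl)
    · exact D.lower' inf_le_left hq
    · exact D.lower' inf_le_right hp
  · intro h p hp
    have := h ((inf_le_right : A ⊓ C ≤ C) hp) p ((inf_le_left : A ⊓ C ≤ A) hp)
    rwa [inf_idem] at this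

instance : Order.Frame (LocProd L M) :=
  Order.Frame.ofMinimalAxioms
    { inf_sSup_le_iSup_inf := fun A S => by
        rw [inf_le_iff_le_residual]
        refine sSup_le fun C hC => ?_
        rw [← inf_le_iff_le_residual]
        exact le_iSup₂ (f := fun C (_ : C ∈ S) => A ⊓ C) C hC }

end LocProd

/-- The localic product `L ⊕ M` of two locales. -/
def Locale.prod (L M : Locale.{u}) : Locale.{u} := Locale.of (LocProd L M)

/-! ### The product of a family of locales -/

open Classical in
/-- The underlying set of the localic product of a family of frames `L i`. Its elements are sets
of boxes `∏ i, x i` with `x i = ⊤` for all but finitely many `i`, which are downwards closed (among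
such boxes) and closed under arbitrary (including empty) joins in each coordinate. -/
@[ext]
structure LocPi {I : Type v} (L : I → Type u) [∀ i, Order.Frame (L i)] where
  carrier : Set (∀ i, L i)
  finite' : ∀ x ∈ carrier, {i | x i ≠ ⊤}.Finite
  lower' : ∀ x ∈ carrier, ∀ y ≤ x, {i | y i ≠ ⊤}.Finite → y ∈ carrier
  sSup' : ∀ x : ∀ i, L i, {i | x i ≠ ⊤}.Finite → ∀ (i : I) (S : Set (L i)),
    (∀ s ∈ S, Function.update x i s ∈ carrier) → Function.update x i (sSup S) ∈ carrier

namespace LocPi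

variable {I : Type v} {L : I → Type u} [∀ i, Order.Frame (L i)]

open Classical in
theorem finite_update {x : ∀ i, L i} (hx : {i | x i ≠ ⊤}.Finite) (i : I) (s : L i) :
    {j | Function.update x i s j ≠ ⊤}.Finite := by
  refine (hx.insert i).subset fun j hj => ?_
  by_cases h : j = i
  · exact Or.inl h
  · right
    simpa [Function.update_of_ne h] using hj

theorem finite_inf {x y : ∀ i, L i} (hx : {i | x i ≠ ⊤}.Finite) (hy : {i | y i ≠ ⊤}.Finite) :
    {i | (x ⊓ y) i ≠ ⊤}.Finite := by
  refine (hx.union hy).subset fun i hi => ?_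
  by_contra h
  simp only [Set.mem_union, Set.mem_ofPred_eq, not_or, not_not] at h
  exact hi (by simp [h.1, h.2])

/-- Elements of the localic product are ordered by inclusion. -/
instance : PartialOrder (LocPi L) :=
  PartialOrder.lift LocPi.carrier (fun _ _ h => LocPi.ext h)

instance : InfSet (LocPi L) where
  sInf T :=
    { carrier := {x | {i | x i ≠ ⊤}.Finite ∧ ∀ A ∈ T, x ∈ A.carrier}
      finite' := fun _ hx => hx.1
      lower' := fun x hx y hyx hy => ⟨hy, fun A hA => A.lower' x (hx.2 A hA) y hyx hy⟩
      sSup' := fun x hx i S h =>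
        ⟨finite_update hx i _, fun A hA => A.sSup' x hx i S fun s hs => (h s hs).2 A hA⟩ }

instance : CompleteLattice (LocPi L) :=
  completeLatticeOfInf _ fun _ =>
    ⟨fun A hA _ hx => hx.2 A hA,
      fun B hB x hx => show _ ∧ _ from ⟨B.finite' x hx, fun _ hA => hB hA hx⟩⟩

/-- The relative pseudocomplement, used to verify the infinite distributive law. -/
def residual (A B : LocPi L) : LocPi L where
  carrier := {x | {i | x i ≠ ⊤}.Finite ∧ ∀ y ∈ A.carrier, y ⊓ x ∈ B.carrier}
  finite' := fun _ hx => hx.1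
  lower' := fun _ hx z hz hzf => ⟨hzf, fun y hy =>
    B.lower' _ (hx.2 y hy) _ (inf_le_inf_left y hz) (finite_inf (A.finite' y hy) hzf)⟩
  sSup' := by
    classical
    intro x hx i S h
    refine ⟨finite_update hx i _, fun y hy => ?_⟩
    have key : ∀ s : L i,
        y ⊓ Function.update x i s = Function.update (y ⊓ x) i (y i ⊓ s) := by
      intro s
      funext j
      by_cases hj : j = i
      · subst hj
        simp
      · simp [Function.update_of_ne hj]
    have := B.sSup' (y ⊓ x) (finite_inf (A.finite' y hy) hx) i ((fun s => y i ⊓ s) '' S) (by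
      rintro _ ⟨s, hs, rfl⟩
      have := (h s hs).2 y hy
      convert this using 1
      rw [key]
      )
    rw [sSup_image, ← inf_sSup_eq] at this
    convert this using 1
    rw [key]

theorem inf_le_iff_le_residual (A B C : LocPi L) : A ⊓ C ≤ B ↔ C ≤ residual A B := by
  constructor
  · intro h x hx
    refine ⟨C.finite' x hx, fun y hy => ?_⟩
    have hf := finite_inf (A.finite' y hy) (C.finite' x hx)
    have h1 : sInf {A, C} ≤ B := le_trans (le_inf (sInf_le (by simp)) (sInf_le (by simp))) h
    refine h1 ⟨hf, ?_⟩
    rintro D (rfl | rfl)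
    · exact D.lower' y hy _ inf_le_left hf
    · exact D.lower' x hx _ inf_le_right hf
  · intro h x hx
    have := (h ((inf_le_right : A ⊓ C ≤ C) hx)).2 x ((inf_le_left : A ⊓ C ≤ A) hx)
    rwa [inf_idem] at this

instance : Order.Frame (LocPi L) :=
  Order.Frame.ofMinimalAxioms
    { inf_sSup_le_iSup_inf := fun A S => by
        rw [inf_le_iff_le_residual]
        refine sSup_le fun C hC => ?_
        rw [← inf_le_iff_le_residual]
        exact le_iSup₂ (f := fun C (_ : C ∈ S) => A ⊓ C) C hC }

end LocPi

/-- The localic product `⨁ i, L i` of a family of locales. -/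
def Locale.pi {I : Type u} (L : I → Locale.{u}) : Locale.{u} := Locale.of (LocPi fun i => L i)

/-! ### The spaces -/

/-- The Sorgenfrey line: the real numbers with the topology generated by the half-open
intervals `[a, b)`. -/
def SorgenfreyLine : Type := ℝ

instance : TopologicalSpace SorgenfreyLine :=
  TopologicalSpace.generateFrom {s : Set ℝ | ∃ a b : ℝ, s = Set.Ico a b}

/-- A tree on `ω` (a set of finite sequences closed under initial segments) is wellfounded if it
has no infinite branch. -/
def IsWellfoundedTree (T : Descriptive.tree ℕ) : Prop :=
  ¬ ∃ x : ℕ → ℕ, ∀ n : ℕ, List.ofFn (fun i : Fin n => x i) ∈ T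

/-- The type of wellfounded trees on `ω`. -/
def WFTree : Type := {T : Descriptive.tree ℕ // IsWellfoundedTree T}

open Classical in
/-- The characteristic function of a wellfounded tree. -/
noncomputable def WFTree.char (T : WFTree) : List ℕ → Bool := fun s => decide (s ∈ T.1)

/-- The space of wellfounded trees is topologized as a subspace of the Cantor space
`2 ^ (ω ^ {<ω})`, by identifying a tree with its characteristic function. -/
noncomputable instance : TopologicalSpace WFTree :=
  TopologicalSpace.induced WFTree.char inferInstance

/-!
A localic product of Hausdorff spaces has as its points the points of the product space, since
Hausdorff spaces are sober. Hence it is not spatial as soon as it has an element `C ≠ ⊤` containing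
boxes that cover the product space, because no point avoids such a `C`
(`LocProd.not_isSpatial_of_cover`, `LocPi.not_isSpatial_of_cover`). In each case below, `C` consists
of the boxes that admit no witness of a suitable kind, where witnesses are more general than points
of the product space. Closure under joins holds because a witness for a join can be replaced by a
witness for one of its members.

* If `Y` and `Z` map to `X` by semi-open maps `f` and `g` with dense ranges, `C` consists of the
  boxes `U × V` for which the regular open hulls of `f '' U` and `g '' V` are disjoint
  (`LocProd.disjointHulls`). This element contains small boxes around any point of the product if `f`
  and `g` are embeddings with disjoint ranges in a Hausdorff space, which covers disjoint dense
  subspaces, as well as `ℚ` with its copies `ℚ` and `ℚ + √2` in the real line. It also does so for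
  the maps `x ↦ x` and `x ↦ -x` from the Sorgenfrey line to the real line.
* For wellfounded trees, `C` consists of the boxes `U × V` such that no tree in the largest open
  extension of `U` to the space of all trees has an infinite branch in `V` (`WFTree.noBranch`). A
  wellfounded tree `T` and a sequence `x` are separated by an initial segment of `x` not in `T`. That
  `C` is closed under joins follows by approximating a tree by its wellfounded truncations, and by
  adding to a wellfounded tree an infinite branch through any of its nodes, without affecting a
  given finite set of other nodes.
* For `⨁ i, Ω ω`, `C` consists of the boxes without a function that is injective on a finite set of
  relevant coordinates (`LocPi.noInjection`). Finite injections extend to further coordinates, while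
  there is no injection of an uncountable index set into `ω`, so the boxes `{f | f i = f j = n}` with
  `i ≠ j`, which belong to `C`, cover the product space.
-/

/-! ### Points of locales -/

/-- In a spatial locale every element other than `⊤` is avoided by some point. -/
theorem Locale.IsSpatial.exists_point {F : Type u} [Order.Frame F] (h : (Locale.of F).IsSpatial)
    {a : F} (ha : a ≠ ⊤) : ∃ p : FrameHom F Prop, ¬ p a := by
  obtain ⟨X, ⟨e⟩⟩ := h
  -- Arrows of locales are reversed: `e.inv.unop` is a frame map from `F` to the opens of `X`.
  let φ : FrameHom F (Opens X) := e.inv.unop.hom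
  let ψ : FrameHom (Opens X) F := e.hom.unop.hom
  have hψφ : ∀ b, ψ (φ b) = b := fun b => by
    have h1 : e.inv.unop ≫ e.hom.unop = 𝟙 _ := by
      have := congrArg Quiver.Hom.unop e.hom_inv_id
      exact this
    exact congrArg (fun k : Frm.of F ⟶ Frm.of F => k.hom b) h1
  have hφ : φ a ≠ ⊤ := fun h' => ha (by rw [← hψφ a, h', map_top])
  obtain ⟨x, hx⟩ : ∃ x, x ∉ φ a := by
    by_contra! hall
    exact hφ (by ext x; simp [hall x])
  exact ⟨(Locale.localePointOfSpacePoint X x).comp φ, hx⟩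

/-- Hausdorff spaces are sober. -/
theorem FrameHom.exists_forall_iff_mem_of_t2Space {X : Type u} [TopologicalSpace X] [T2Space X]
    (p : FrameHom (Opens X) Prop) : ∃ x, ∀ U, p U ↔ x ∈ U := by
  -- The points of `X` at which `p` might be evaluation form the complement of `N`.
  set N : Opens X := sSup {U | ¬ p U} with hN
  have hpN : ¬ p N := by
    rw [hN, map_sSup, sSup_Prop_eq]
    rintro ⟨_, ⟨U, hU, rfl⟩, h⟩
    exact hU h
  have hmono : Monotone p := OrderHomClass.mono p
  have hiff : ∀ U, p U ↔ ¬ U ≤ N := fun U =>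
    ⟨fun h hle => hpN (hmono hle h), fun h => by
      by_contra hU
      exact h (le_sSup hU)⟩
  obtain ⟨x, hx⟩ : ∃ x, x ∉ N := by
    by_contra! hall
    exact (hiff ⊤).1 (by simp) fun x _ => hall x
  refine ⟨x, fun U => (hiff U).trans ⟨fun h => ?_, fun hxU h => hx (h hxU)⟩⟩
  obtain ⟨y, hyU, hy⟩ := SetLike.not_le_iff_exists.1 h
  by_contra hxU
  obtain ⟨V, W, hV, hW, hxV, hyW, hVW⟩ := t2_separation (show x ≠ y by rintro rfl; exact hxU hyU)
  have h1 : p ⟨V, hV⟩ := (hiff _).2 fun h => hx (h hxV)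
  have h2 : p ⟨W, hW⟩ := (hiff _).2 fun h => hy (h hyW)
  have h3 : p (⟨V, hV⟩ ⊓ ⟨W, hW⟩) := by
    rw [map_inf]
    exact ⟨h1, h2⟩
  have h4 : (⟨V, hV⟩ ⊓ ⟨W, hW⟩ : Opens X) = ⊥ := by
    ext z
    simpa using fun hz hz' => Set.disjoint_left.1 hVW hz hz'
  rw [h4, map_bot] at h3
  exact h3

/-! ### Nonspatial binary products -/

namespace LocProd

section Hom

variable {L : Type u} {M : Type v} [Order.Frame L] [Order.Frame M]

theorem mem_inf {A B : LocProd L M} {q : L × M} :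
    q ∈ (A ⊓ B).carrier ↔ q ∈ A.carrier ∧ q ∈ B.carrier := by
  refine ⟨fun h => ⟨(inf_le_left : A ⊓ B ≤ A) h, (inf_le_right : A ⊓ B ≤ B) h⟩, fun h => ?_⟩
  have h1 : sInf {A, B} ≤ A ⊓ B := le_inf (sInf_le (by simp)) (sInf_le (by simp))
  refine h1 ?_
  rintro D (rfl | rfl)
  exacts [h.1, h.2]

theorem mem_sSup {T : Set (LocProd L M)} {A : LocProd L M} (hA : A ∈ T) {q : L × M}
    (hq : q ∈ A.carrier) : q ∈ (sSup T).carrier :=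
  (le_sSup hA : A ≤ sSup T) hq

theorem mem_of_snd_eq_bot (A : LocProd L M) {q : L × M} (h : q.2 = ⊥) : q ∈ A.carrier := by
  obtain ⟨a, b⟩ := q
  obtain rfl : b = ⊥ := h
  simpa using A.sSup_right' a ∅ (by simp)

theorem mem_of_fst_eq_bot (A : LocProd L M) {q : L × M} (h : q.1 = ⊥) : q ∈ A.carrier := by
  obtain ⟨a, b⟩ := q
  obtain rfl : a = ⊥ := h
  simpa using A.sSup_left' ∅ b (by simp)

theorem top_mem : ((⊤, ⊤) : L × M) ∈ (⊤ : LocProd L M).carrier := by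
  have h : sInf ∅ ≤ (⊤ : LocProd L M) := le_top
  exact h fun A hA => hA.elim

variable (L M) in
/-- The frame map dual to the first projection `L ⊕ M → L`. It sends `a` to the box `a × ⊤`, which
also contains all pairs whose second coordinate is `⊥`. -/
def fstHom : FrameHom L (LocProd L M) where
  toFun a :=
    { carrier := {q | q.1 ≤ a ∨ q.2 = ⊥}
      lower' := fun _ _ h => Or.imp h.1.trans fun h' => le_bot_iff.1 (h' ▸ h.2)
      sSup_left' := fun S b h => by
        by_cases hb : b = ⊥
        · exact Or.inr hb
        · exact Or.inl (sSup_le fun c hc => (h c hc).resolve_right hb)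
      sSup_right' := fun c S h => by
        by_cases hc : c ≤ a
        · exact Or.inl hc
        · exact Or.inr (sSup_eq_bot.2 fun b hb => (h b hb).resolve_left hc) }
  map_inf' a b := by
    ext q
    rw [mem_inf]
    change (q.1 ≤ a ⊓ b ∨ q.2 = ⊥) ↔ (q.1 ≤ a ∨ q.2 = ⊥) ∧ (q.1 ≤ b ∨ q.2 = ⊥)
    rw [le_inf_iff]
    tauto
  map_top' := top_unique fun _ _ => Or.inl le_top
  map_sSup' S := by
    refine le_antisymm ?_ (sSup_le ?_)
    · rintro ⟨c, d⟩ (h | h)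
      · refine LocProd.lower' _ (show (c, d) ≤ (sSup S, d) from ⟨h, le_rfl⟩) ?_
        exact LocProd.sSup_left' _ S d fun a ha =>
          mem_sSup (Set.mem_image_of_mem _ ha) (Or.inl le_rfl)
      · exact mem_of_snd_eq_bot _ h
    · rintro _ ⟨a, ha, rfl⟩ q (h | h)
      · exact Or.inl (h.trans (le_sSup ha))
      · exact Or.inr h

variable (L M) in
/-- The frame map dual to the second projection `L ⊕ M → M`. It sends `b` to the box `⊤ × b`, which
also contains all pairs whose first coordinate is `⊥`. -/
def sndHom : FrameHom M (LocProd L M) where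
  toFun b :=
    { carrier := {q | q.2 ≤ b ∨ q.1 = ⊥}
      lower' := fun _ _ h => Or.imp h.2.trans fun h' => le_bot_iff.1 (h' ▸ h.1)
      sSup_left' := fun S d h => by
        by_cases hd : d ≤ b
        · exact Or.inl hd
        · exact Or.inr (sSup_eq_bot.2 fun a ha => (h a ha).resolve_left hd)
      sSup_right' := fun a S h => by
        by_cases ha : a = ⊥
        · exact Or.inr ha
        · exact Or.inl (sSup_le fun c hc => (h c hc).resolve_right ha) }
  map_inf' a b := by
    ext q
    rw [mem_inf]
    change (q.2 ≤ a ⊓ b ∨ q.1 = ⊥) ↔ (q.2 ≤ a ∨ q.1 = ⊥) ∧ (q.2 ≤ b ∨ q.1 = ⊥)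
    rw [le_inf_iff]
    tauto
  map_top' := top_unique fun _ _ => Or.inl le_top
  map_sSup' S := by
    refine le_antisymm ?_ (sSup_le ?_)
    · rintro ⟨c, d⟩ (h | h)
      · refine LocProd.lower' _ (show (c, d) ≤ (c, sSup S) from ⟨le_rfl, h⟩) ?_
        exact LocProd.sSup_right' _ c S fun a ha =>
          mem_sSup (Set.mem_image_of_mem _ ha) (Or.inl le_rfl)
      · exact mem_of_fst_eq_bot _ h
    · rintro _ ⟨a, ha, rfl⟩ q (h | h)
      · exact Or.inl (h.trans (le_sSup ha))
      · exact Or.inr h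

theorem fstHom_inf_sndHom_le {A : LocProd L M} {a : L} {b : M} (h : (a, b) ∈ A.carrier) :
    fstHom L M a ⊓ sndHom L M b ≤ A := by
  intro q hq
  obtain ⟨h1 | h1, h2 | h2⟩ := mem_inf.1 hq
  · exact A.lower' ⟨h1, h2⟩ h
  · exact A.mem_of_fst_eq_bot h2
  · exact A.mem_of_snd_eq_bot h1
  · exact A.mem_of_fst_eq_bot h2

end Hom

/-- If an element `C` of the localic product of two Hausdorff spaces contains boxes covering the
product space but not the whole box `⊤ × ⊤`, then the localic product is not spatial: points of the
product locale are pairs of points, so no point avoids `C`. -/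
theorem not_isSpatial_of_cover {X Y : Type u} [TopologicalSpace X] [TopologicalSpace Y]
    [T2Space X] [T2Space Y] (C : LocProd (Opens X) (Opens Y))
    (hcover : ∀ x y, ∃ U V, x ∈ U ∧ y ∈ V ∧ (U, V) ∈ C.carrier) (htop : (⊤, ⊤) ∉ C.carrier) :
    ¬ (Locale.prod (omegaLocale X) (omegaLocale Y)).IsSpatial := by
  intro h
  have h' : (Locale.of (LocProd (Opens X) (Opens Y))).IsSpatial := h
  obtain ⟨p, hp⟩ := h'.exists_point (a := C) fun hC => htop (hC ▸ top_mem)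
  obtain ⟨x, hx⟩ := (p.comp (fstHom (Opens X) (Opens Y))).exists_forall_iff_mem_of_t2Space
  obtain ⟨y, hy⟩ := (p.comp (sndHom (Opens X) (Opens Y))).exists_forall_iff_mem_of_t2Space
  obtain ⟨U, V, hxU, hyV, hUV⟩ := hcover x y
  refine hp (OrderHomClass.mono p (fstHom_inf_sndHom_le hUV) ?_)
  rw [map_inf]
  exact ⟨(hx U).2 hxU, (hy V).2 hyV⟩

end LocProd

/-! ### Disjoint dense images -/

theorem DenseRange.subset_closure_image_preimage {X Y : Type*} [TopologicalSpace X] {f : Y → X}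
    (hd : DenseRange f) {O : Set X} (hO : IsOpen O) : O ⊆ closure (f '' (f ⁻¹' O)) := by
  rw [Set.image_preimage_eq_inter_range]
  exact hd.open_subset_closure_inter hO

section SemiOpen

variable {X : Type*} {Y : Type*} [TopologicalSpace X] [TopologicalSpace Y]

/-- A map is semi-open if the image of each open set lies in the closure of its regular open hull,
the interior of its closure. Continuity is not required. -/
def IsSemiOpenMap (f : Y → X) : Prop :=
  ∀ U : Set Y, IsOpen U → f '' U ⊆ closure (interior (closure (f '' U)))

theorem Topology.IsInducing.isSemiOpenMap {f : Y → X} (hf : IsInducing f) (hd : DenseRange f) :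
    IsSemiOpenMap f := by
  rintro U hU
  obtain ⟨O, hO, rfl⟩ := hf.isOpen_iff.1 hU
  exact (Set.image_preimage_subset f O).trans
    ((interior_maximal (hd.subset_closure_image_preimage hO) hO).trans subset_closure)

/-- The regular open hulls of images under a semi-open map commute with unions as far as
disjointness from open sets is concerned. -/
theorem IsSemiOpenMap.disjoint_sSup {f : Y → X} (hf : IsSemiOpenMap f) {S : Set (Opens Y)}
    {W : Set X} (hW : IsOpen W)
    (h : ∀ U ∈ S, Disjoint (interior (closure (f '' (U : Set Y)))) W) :
    Disjoint (interior (closure (f '' ((sSup S : Opens Y) : Set Y)))) W := by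
  rw [Set.disjoint_left]
  intro x hx hxW
  obtain ⟨_, ⟨_, hyW⟩, y, hy, rfl⟩ :=
    mem_closure_iff.1 (interior_subset hx) _ (isOpen_interior.inter hW) ⟨hx, hxW⟩
  obtain ⟨U, hU, hyU⟩ := Opens.mem_sSup.1 hy
  obtain ⟨z, hzW, hz⟩ := mem_closure_iff.1 (hf U U.isOpen ⟨y, hyU, rfl⟩) W hW hyW
  exact Set.disjoint_left.1 (h U hU) hz hzW

end SemiOpen

/-- For semi-open maps `f : Y → X` and `g : Z → X`, the element of `Ω Y ⊕ Ω Z` consisting of the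
boxes `U × V` for which the regular open hulls of `f '' U` and `g '' V` are disjoint. -/
def LocProd.disjointHulls {X : Type*} {Y : Type u} {Z : Type v} [TopologicalSpace X]
    [TopologicalSpace Y] [TopologicalSpace Z] {f : Y → X} {g : Z → X} (hf : IsSemiOpenMap f)
    (hg : IsSemiOpenMap g) : LocProd (Opens Y) (Opens Z) where
  carrier := {q | Disjoint (interior (closure (f '' (q.1 : Set Y))))
    (interior (closure (g '' (q.2 : Set Z))))}
  lower' := fun _ _ h hq => Disjoint.mono
    (interior_mono (closure_mono (Set.image_mono h.1)))
    (interior_mono (closure_mono (Set.image_mono h.2))) hq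
  sSup_left' := fun _ _ h => hf.disjoint_sSup isOpen_interior h
  sSup_right' := fun _ _ h => (hg.disjoint_sSup isOpen_interior fun V hV => (h V hV).symm).symm

/-- If `f : Y → X` and `g : Z → X` are semi-open with dense range, and any two points of `Y` and `Z`
have neighbourhoods whose images have disjoint regular open hulls, then `Ω Y ⊕ Ω Z` is not
spatial. -/
theorem not_isSpatial_of_isSemiOpenMap {X : Type*} {Y Z : Type u} [TopologicalSpace X]
    [TopologicalSpace Y] [TopologicalSpace Z] [T2Space Y] [T2Space Z] [Nonempty X]
    {f : Y → X} {g : Z → X} (hf : IsSemiOpenMap f) (hg : IsSemiOpenMap g)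
    (hfd : DenseRange f) (hgd : DenseRange g)
    (h : ∀ y z, ∃ (U : Opens Y) (V : Opens Z), y ∈ U ∧ z ∈ V ∧
      Disjoint (interior (closure (f '' (U : Set Y)))) (interior (closure (g '' (V : Set Z))))) :
    ¬ (Locale.prod (omegaLocale Y) (omegaLocale Z)).IsSpatial := by
  refine LocProd.not_isSpatial_of_cover (LocProd.disjointHulls hf hg) h fun htop => ?_
  have h1 : Disjoint (interior (closure (f '' Set.univ))) (interior (closure (g '' Set.univ))) :=
    htop
  simp [hfd.closure_range, hgd.closure_range] at h1

theorem not_isSpatial_of_isEmbedding {X : Type*} {Y Z : Type u} [TopologicalSpace X]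
    [TopologicalSpace Y] [TopologicalSpace Z] [T2Space X] [Nonempty X] {f : Y → X} {g : Z → X}
    (hf : Topology.IsEmbedding f) (hg : Topology.IsEmbedding g) (hfd : DenseRange f)
    (hgd : DenseRange g) (hfg : ∀ y z, f y ≠ g z) :
    ¬ (Locale.prod (omegaLocale Y) (omegaLocale Z)).IsSpatial := by
  have := hf.t2Space
  have := hg.t2Space
  refine not_isSpatial_of_isSemiOpenMap (hf.isInducing.isSemiOpenMap hfd)
    (hg.isInducing.isSemiOpenMap hgd) hfd hgd fun y z => ?_
  obtain ⟨O, O', hO, hO', hy, hz, hd⟩ := t2_separation (hfg y z)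
  refine ⟨⟨f ⁻¹' O, hO.preimage hf.continuous⟩, ⟨g ⁻¹' O', hO'.preimage hg.continuous⟩, hy, hz, ?_⟩
  have h1 : Disjoint (interior (closure O)) (closure O') :=
    ((hd.closure_left hO').mono_left interior_subset).closure_right isOpen_interior
  exact h1.mono (interior_mono (closure_mono (Set.image_preimage_subset f O)))
    (interior_subset.trans (closure_mono (Set.image_preimage_subset g O')))

/-- The rationals and their translate by `√2` are disjoint dense subspaces of the real line. -/
theorem not_isSpatial_rat_prod_rat :
    ¬ (Locale.prod (omegaLocale ℚ) (omegaLocale ℚ)).IsSpatial := by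
  let e : ℝ ≃ₜ ℝ := Homeomorph.addRight √2
  have hc : Topology.IsEmbedding ((↑) : ℚ → ℝ) := Rat.isEmbedding_coe_real
  refine not_isSpatial_of_isEmbedding (f := ((↑) : ℚ → ℝ)) (g := e ∘ ((↑) : ℚ → ℝ)) hc
    (e.isEmbedding.comp hc) Rat.denseRange_cast
    (e.surjective.denseRange.comp Rat.denseRange_cast e.continuous) fun y z h => ?_
  refine irrational_sqrt_two ⟨y - z, ?_⟩
  have h' : (y : ℝ) = z + √2 := h
  push_cast
  linarith

/-! ### The Sorgenfrey line -/

namespace SorgenfreyLine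

/-- The identity, from the Sorgenfrey line to the real line with its usual topology. -/
def toReal (x : SorgenfreyLine) : ℝ := x

/-- The identity, from the real line with its usual topology to the Sorgenfrey line. -/
def ofReal (x : ℝ) : SorgenfreyLine := x

/-- The half-open interval `[a, b)` as an open subset of the Sorgenfrey line. -/
def Ico (a b : ℝ) : Opens SorgenfreyLine :=
  ⟨toReal ⁻¹' Set.Ico a b, .basic _ ⟨a, b, rfl⟩⟩

theorem exists_Ico_subset {U : Set SorgenfreyLine} (hU : IsOpen U) {x : SorgenfreyLine}
    (hx : x ∈ U) : ∃ b, x.toReal < b ∧ ∀ y : ℝ, x.toReal ≤ y → y < b → ofReal y ∈ U := by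
  induction hU with
  | basic s hs =>
    obtain ⟨a, b, rfl⟩ := hs
    exact ⟨b, hx.2, fun y hy hyb => ⟨le_trans (show a ≤ x.toReal from hx.1) hy, hyb⟩⟩
  | univ => exact ⟨x.toReal + 1, by simp, fun _ _ _ => trivial⟩
  | inter s t _ _ hs ht =>
    obtain ⟨b, hb, h⟩ := hs hx.1
    obtain ⟨c, hc, h'⟩ := ht hx.2
    exact ⟨min b c, lt_min hb hc, fun y hy hyb =>
      ⟨h y hy (hyb.trans_le (min_le_left _ _)), h' y hy (hyb.trans_le (min_le_right _ _))⟩⟩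
  | sUnion S _ ih =>
    obtain ⟨s, hs, hxs⟩ := hx
    obtain ⟨b, hb, h⟩ := ih s hs hxs
    exact ⟨b, hb, fun y hy hyb => ⟨s, hs, h y hy hyb⟩⟩

theorem continuous_toReal : Continuous toReal := by
  rw [continuous_def]
  intro s hs
  rw [isOpen_iff_forall_mem_open]
  intro x hx
  obtain ⟨ε, hε, h⟩ := Metric.isOpen_iff.1 hs x.toReal hx
  rw [Real.ball_eq_Ioo] at h
  exact ⟨Ico x.toReal (x.toReal + ε), fun y hy => h ⟨(sub_lt_self _ hε).trans_le hy.1, hy.2⟩,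
    (Ico _ _).isOpen, le_rfl, lt_add_of_pos_right _ hε⟩

instance : T2Space SorgenfreyLine :=
  .of_injective_continuous (f := toReal) (fun _ _ h => h) continuous_toReal

theorem isSemiOpenMap_toReal : IsSemiOpenMap toReal := by
  rintro U hU _ ⟨x, hx, rfl⟩
  obtain ⟨b, hb, h⟩ := exists_Ico_subset hU hx
  have h1 : Set.Ioo x.toReal b ⊆ interior (closure (toReal '' U)) :=
    interior_maximal (fun y hy => subset_closure ⟨ofReal y, h y hy.1.le hy.2, rfl⟩) isOpen_Ioo
  refine closure_mono h1 ?_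
  rw [closure_Ioo hb.ne]
  exact Set.left_mem_Icc.2 hb.le

theorem isSemiOpenMap_neg_toReal : IsSemiOpenMap fun x : SorgenfreyLine => -x.toReal := by
  rintro U hU _ ⟨x, hx, rfl⟩
  obtain ⟨b, hb, h⟩ := exists_Ico_subset hU hx
  have h1 : Set.Ioo (-b) (-x.toReal) ⊆
      interior (closure ((fun x : SorgenfreyLine => -x.toReal) '' U)) :=
    interior_maximal (fun y hy => subset_closure
      ⟨ofReal (-y), h (-y) (by linarith [hy.2]) (by linarith [hy.1]), neg_neg y⟩) isOpen_Ioo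
  refine closure_mono h1 ?_
  rw [closure_Ioo (neg_lt_neg hb).ne]
  exact Set.right_mem_Icc.2 (neg_le_neg hb.le)

/-- The maps `x ↦ x` and `x ↦ -x` to the real line turn right neighbourhoods of `x` and `y` into a
right neighbourhood of `x` and a left neighbourhood of `-y`; small ones have disjoint interiors,
even when `x = -y`. -/
theorem not_isSpatial_prod :
    ¬ (Locale.prod (omegaLocale SorgenfreyLine) (omegaLocale SorgenfreyLine)).IsSpatial := by
  refine not_isSpatial_of_isSemiOpenMap isSemiOpenMap_toReal isSemiOpenMap_neg_toReal
    (Function.Surjective.denseRange fun x => ⟨ofReal x, rfl⟩)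
    (Function.Surjective.denseRange fun x => ⟨ofReal (-x), neg_neg x⟩) fun x y => ?_
  obtain ⟨ε, hε, h⟩ : ∃ ε > 0, -y.toReal ≤ x.toReal ∨ x.toReal + ε ≤ -y.toReal - ε := by
    by_cases h : -y.toReal ≤ x.toReal
    · exact ⟨1, one_pos, Or.inl h⟩
    · exact ⟨(-y.toReal - x.toReal) / 2, by linarith, Or.inr (by linarith)⟩
  refine ⟨Ico x.toReal (x.toReal + ε), Ico y.toReal (y.toReal + ε), ⟨le_rfl, by simpa⟩,
    ⟨le_rfl, by simpa⟩, ?_⟩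
  have h1 : interior (closure (toReal '' (Ico x.toReal (x.toReal + ε) : Set SorgenfreyLine))) ⊆
      Set.Ioo x.toReal (x.toReal + ε) := by
    rw [← interior_Icc]
    refine interior_mono (closure_minimal ?_ isClosed_Icc)
    rintro _ ⟨z, hz, rfl⟩
    exact ⟨hz.1, hz.2.le⟩
  have h2 : interior (closure ((fun x : SorgenfreyLine => -x.toReal) ''
      (Ico y.toReal (y.toReal + ε) : Set SorgenfreyLine))) ⊆
      Set.Ioo (-y.toReal - ε) (-y.toReal) := by
    rw [← interior_Icc]
    refine interior_mono (closure_minimal ?_ isClosed_Icc)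
    rintro _ ⟨z, hz, rfl⟩
    exact ⟨by linarith [hz.2], neg_le_neg hz.1⟩
  refine Set.disjoint_left.2 fun z hz hz' => ?_
  have := h1 hz
  have := h2 hz'
  simp only [Set.mem_Ioo] at *
  rcases h with h | h <;> linarith

end SorgenfreyLine

/-! ### Wellfounded trees -/

namespace WFTree

theorem char_injective : Function.Injective char := by
  intro S T h
  refine Subtype.ext (SetLike.ext fun s => ?_)
  simpa [char] using congrFun h s

instance : T2Space WFTree :=
  .of_injective_continuous char_injective continuous_induced_dom

/-- Two trees agree on a set of nodes if they contain the same nodes of that set. -/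
def AgreeOn (F : Finset (List ℕ)) (S T : Descriptive.tree ℕ) : Prop :=
  ∀ s ∈ F, s ∈ S ↔ s ∈ T

theorem exists_finset_of_isOpen {U : Set WFTree} (hU : IsOpen U) {S : WFTree} (hS : S ∈ U) :
    ∃ F : Finset (List ℕ), ∀ T : WFTree, AgreeOn F S.1 T.1 → T ∈ U := by
  obtain ⟨O, hO, rfl⟩ := isOpen_induced_iff.1 hU
  obtain ⟨F, u, hu, h⟩ := isOpen_pi_iff.1 hO _ hS
  refine ⟨F, fun T hT => h fun s hs => ?_⟩
  have : T.char s = S.char s := by simp [char, hT s hs]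
  rw [this]
  exact (hu s hs).2

/-- The wellfounded trees not containing a given node, as an open set. -/
def avoiding (s : List ℕ) : Opens WFTree where
  carrier := {T | s ∉ T.1}
  is_open' := by
    classical
    have h : IsOpen ((fun T : WFTree => T.char s) ⁻¹' {false}) :=
      (isOpen_discrete _).preimage ((continuous_apply s).comp continuous_induced_dom)
    convert h using 1
    ext T
    simp [char]

/-- `x` is an infinite branch of `T`. -/
def IsBranch (x : ℕ → ℕ) (T : Descriptive.tree ℕ) : Prop :=
  ∀ n : ℕ, List.ofFn (fun i : Fin n => x i) ∈ T

/-- Truncating a tree at a finite level makes it wellfounded. -/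
theorem exists_agreeOn (T : Descriptive.tree ℕ) (F : Finset (List ℕ)) :
    ∃ S : WFTree, AgreeOn F T S.1 := by
  let N := F.sup List.length
  refine ⟨⟨⟨{s | s ∈ T ∧ s.length ≤ N}, fun s a h => ⟨T.2 h.1, ?_⟩⟩, ?_⟩, fun s hs => ?_⟩
  · have := h.2
    simp at this
    omega
  · rintro ⟨x, hx⟩
    have := (hx (N + 1)).2
    simp at this
  · exact ⟨fun h => ⟨h, Finset.le_sup (f := List.length) hs⟩, fun h => h.1⟩

/-- Given a node `x 0, …, x (n - 1)` of a tree, adding a new infinite branch through it, whose later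
entries exceed all numbers occurring in `F`, does not change the tree on `F`. -/
theorem exists_agreeOn_isBranch (S : Descriptive.tree ℕ) (F : Finset (List ℕ)) (x : ℕ → ℕ) (n : ℕ)
    (hx : List.ofFn (fun i : Fin n => x i) ∈ S) :
    ∃ (T : Descriptive.tree ℕ) (y : ℕ → ℕ), AgreeOn F S T ∧ IsBranch y T ∧ ∀ i < n, y i = x i := by
  let m := F.sup List.sum + 1
  let y : ℕ → ℕ := fun i => if i < n then x i else m
  have hy : ∀ i < n, y i = x i := fun i hi => if_pos hi
  let B : Descriptive.tree ℕ :=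
    ⟨{s | ∃ k, s = List.ofFn fun i : Fin k => y i}, by
      rintro s a ⟨k, hk⟩
      obtain _ | k := k
      · simp at hk
      · rw [List.ofFn_succ_last] at hk
        exact ⟨k, (List.append_inj' hk rfl).1⟩⟩
  refine ⟨S ⊔ B, y, fun s hs => ⟨fun h => Or.inl h, ?_⟩, fun k => Or.inr ⟨k, rfl⟩, hy⟩
  rintro (h | ⟨k, rfl⟩)
  · exact h
  · rcases le_or_gt k n with hk | hk
    · -- the node is an initial segment of the given one
      have h1 : List.ofFn (fun i : Fin k => y i) = (List.ofFn fun i : Fin n => x i).take k := by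
        refine List.ext_getElem (by simpa using hk) fun i hi _ => ?_
        have : i < k := by simpa using hi
        simpa using hy i (by omega)
      rw [h1]
      exact Descriptive.Tree.mem_of_prefix (List.take_prefix _ _) hx
    · -- the node contains the entry `m`, so it is not in `F`
      have h1 : m ∈ List.ofFn (fun i : Fin k => y i) :=
        List.mem_ofFn.2 ⟨⟨n, hk⟩, if_neg (lt_irrefl n)⟩
      have h2 := List.le_sum_of_mem h1
      have h3 := Finset.le_sup (f := List.sum) hs
      omega

theorem exists_forall_mem_of_isOpen {V : Set (ℕ → ℕ)} (hV : IsOpen V) {x : ℕ → ℕ} (hx : x ∈ V) :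
    ∃ n, ∀ y : ℕ → ℕ, (∀ i < n, y i = x i) → y ∈ V := by
  obtain ⟨I, u, hu, h⟩ := isOpen_pi_iff.1 hV x hx
  refine ⟨I.sup id + 1, fun y hy => h fun i hi => ?_⟩
  rw [hy i (Nat.lt_succ_of_le (Finset.le_sup (f := id) hi))]
  exact (hu i hi).2

/-- `AlmostContains U T` says that `T` lies in the largest open set of trees whose trace on the
space of wellfounded trees is contained in `U`. -/
def AlmostContains (U : Set WFTree) (T : Descriptive.tree ℕ) : Prop :=
  ∃ F : Finset (List ℕ), ∀ S : WFTree, AgreeOn F T S.1 → S ∈ U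

/-- The element of `Ω WF ⊕ Ω (ω ^ ω)` consisting of the boxes `U × V` such that no tree in the
largest open extension of `U` to the space of all trees has an infinite branch in `V`. -/
def noBranch : LocProd (Opens WFTree) (Opens (ℕ → ℕ)) where
  carrier := {q | ∀ T x, AlmostContains q.1 T → IsBranch x T → x ∉ q.2}
  lower' := by
    rintro q r h hq T x ⟨F, hF⟩ hx hxV
    exact hq T x ⟨F, fun S hS => h.1 (hF S hS)⟩ hx (h.2 hxV)
  sSup_left' := by
    classical
    rintro 𝒰 V h T x ⟨F, hF⟩ hx hxV
    obtain ⟨n, hn⟩ := exists_forall_mem_of_isOpen V.isOpen hxV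
    -- Some wellfounded `S` agrees with `T` on `F` and still contains `x 0, …, x (n - 1)`.
    obtain ⟨S, hS⟩ := exists_agreeOn T (insert (List.ofFn fun i : Fin n => x i) F)
    obtain ⟨U, hU, hSU⟩ := Opens.mem_sSup.1 (hF S fun s hs => hS s (Finset.mem_insert_of_mem hs))
    obtain ⟨G, hG⟩ := exists_finset_of_isOpen U.isOpen hSU
    obtain ⟨T', y, hT', hy, hyx⟩ := exists_agreeOn_isBranch S.1 G x n
      ((hS _ (Finset.mem_insert_self _ _)).1 (hx n))
    exact h U hU T' y ⟨G, fun R hR => hG R fun s hs => (hT' s hs).trans (hR s hs)⟩ hy (hn y hyx)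
  sSup_right' := by
    rintro U 𝒱 h T x hT hx hxV
    obtain ⟨V, hV, hxV⟩ := Opens.mem_sSup.1 hxV
    exact h V hV T x hT hx hxV

theorem not_isSpatial_prod_baire :
    ¬ (Locale.prod (omegaLocale WFTree) (omegaLocale (ℕ → ℕ))).IsSpatial := by
  classical
  refine LocProd.not_isSpatial_of_cover noBranch (fun S x => ?_) fun h => ?_
  · obtain ⟨n, hn⟩ : ∃ n : ℕ, List.ofFn (fun i : Fin n => x i) ∉ S.1 := by
      by_contra! h
      exact S.2 ⟨x, h⟩
    let V : Opens (ℕ → ℕ) := ⟨(fun (y : ℕ → ℕ) (i : Fin n) => y i) ⁻¹' {fun i : Fin n => x i},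
      (isOpen_discrete _).preimage (by fun_prop)⟩
    refine ⟨avoiding (List.ofFn fun i : Fin n => x i), V, hn, rfl, ?_⟩
    rintro T y ⟨F, hF⟩ hy hyV
    have hyx : (fun i : Fin n => y i) = fun i : Fin n => x i := hyV
    obtain ⟨R, hR⟩ := exists_agreeOn T (insert (List.ofFn fun i : Fin n => x i) F)
    refine hF R (fun s hs => hR s (Finset.mem_insert_of_mem hs))
      ((hR _ (Finset.mem_insert_self _ _)).1 ?_)
    rw [← hyx]
    exact hy n
  · exact h ⊤ 0 ⟨∅, fun _ _ => trivial⟩ (fun _ => trivial) trivial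

end WFTree

/-! ### Uncountable products -/

namespace LocPi

section Hom

variable {I : Type v} {L : I → Type u} [∀ i, Order.Frame (L i)]

theorem mem_inf {A B : LocPi L} {x : ∀ i, L i} :
    x ∈ (A ⊓ B).carrier ↔ x ∈ A.carrier ∧ x ∈ B.carrier := by
  refine ⟨fun h => ⟨(inf_le_left : A ⊓ B ≤ A) h, (inf_le_right : A ⊓ B ≤ B) h⟩, fun h => ?_⟩
  have h1 : sInf {A, B} ≤ A ⊓ B := le_inf (sInf_le (by simp)) (sInf_le (by simp))
  refine h1 ⟨A.finite' x h.1, ?_⟩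
  rintro D (rfl | rfl)
  exacts [h.1, h.2]

theorem mem_sSup {T : Set (LocPi L)} {A : LocPi L} (hA : A ∈ T) {x : ∀ i, L i}
    (hx : x ∈ A.carrier) : x ∈ (sSup T).carrier :=
  (le_sSup hA : A ≤ sSup T) hx

theorem top_mem : (⊤ : ∀ i, L i) ∈ (⊤ : LocPi L).carrier := by
  have h : sInf ∅ ≤ (⊤ : LocPi L) := le_top
  exact h ⟨by simp, fun A hA => hA.elim⟩

theorem mem_of_eq_bot (A : LocPi L) {x : ∀ i, L i} (hx : {i | x i ≠ ⊤}.Finite) {i : I}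
    (hi : x i = ⊥) : x ∈ A.carrier := by
  classical
  have h := A.sSup' x hx i ∅ (by simp)
  rw [sSup_empty, ← hi, Function.update_eq_self] at h
  convert h

open Classical in
variable (L) in
/-- The frame map dual to the projection of `⨁ i, L i` to the factor `L i`. It sends `a` to the box
with `i`-th side `a` and all other sides `⊤`, which also contains all boxes with some side `⊥`. -/
def projHom (i : I) : FrameHom (L i) (LocPi L) where
  toFun a :=
    { carrier := {x | {j | x j ≠ ⊤}.Finite ∧ (x i ≤ a ∨ ∃ j, x j = ⊥)}
      finite' := fun _ hx => hx.1
      lower' := fun x hx y hyx hy => ⟨hy, hx.2.imp (hyx i).trans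
        fun ⟨j, hj⟩ => ⟨j, le_bot_iff.1 (hj ▸ hyx j)⟩⟩
      sSup' := by
        intro x hx j S h
        refine ⟨finite_update hx j _, ?_⟩
        by_cases hbot : ∃ k, k ≠ j ∧ x k = ⊥
        · obtain ⟨k, hk, hxk⟩ := hbot
          exact Or.inr ⟨k, by simpa [Function.update_of_ne hk] using hxk⟩
        -- Otherwise only the `j`-th side of the boxes `update x j s` can be `⊥`.
        have h' : ∀ s ∈ S, Function.update x j s i ≤ a ∨ s = ⊥ := fun s hs =>
          (h s hs).2.imp_right fun ⟨k, hk⟩ => by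
            by_cases hkj : k = j
            · subst hkj
              simpa using hk
            · exact absurd ⟨k, hkj, by simpa [Function.update_of_ne hkj] using hk⟩ hbot
        by_cases hij : i = j
        · subst hij
          left
          rw [Function.update_self]
          refine sSup_le fun s hs => (h' s hs).elim (fun h => ?_) fun h => h ▸ bot_le
          simpa using h
        · by_cases hxa : x i ≤ a
          · left
            simpa [Function.update_of_ne hij] using hxa
          · right
            refine ⟨j, ?_⟩
            rw [Function.update_self]
            refine sSup_eq_bot.2 fun s hs => (h' s hs).resolve_left ?_
            simpa [Function.update_of_ne hij] using hxa }
  map_inf' a b := by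
    ext x
    rw [mem_inf]
    change (_ ∧ (x i ≤ a ⊓ b ∨ ∃ j, x j = ⊥)) ↔
      (_ ∧ (x i ≤ a ∨ ∃ j, x j = ⊥)) ∧ (_ ∧ (x i ≤ b ∨ ∃ j, x j = ⊥))
    rw [le_inf_iff]
    tauto
  map_top' := by
    refine top_unique fun x hx => ⟨finite' _ _ hx, Or.inl le_top⟩
  map_sSup' S := by
    refine le_antisymm ?_ (sSup_le ?_)
    · rintro x ⟨hx, h | ⟨j, h⟩⟩
      · refine lower' _ (Function.update x i (sSup S))
          (sSup' _ x hx i S fun a ha => mem_sSup (Set.mem_image_of_mem _ ha) ?_) x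
          (le_update_iff.2 ⟨h, fun _ _ => le_rfl⟩) hx
        exact ⟨finite_update hx i a, Or.inl (by simp)⟩
      · exact mem_of_eq_bot _ hx h
    · rintro _ ⟨a, ha, rfl⟩ x ⟨hx, h | h⟩
      · exact ⟨hx, Or.inl (h.trans (le_sSup ha))⟩
      · exact ⟨hx, Or.inr h⟩

theorem mem_projHom {i : I} {a : L i} {x : ∀ i, L i} :
    x ∈ (projHom L i a).carrier ↔ {j | x j ≠ ⊤}.Finite ∧ (x i ≤ a ∨ ∃ j, x j = ⊥) :=
  Iff.rfl

theorem mem_finset_inf {ι : Type*} (t : Finset ι) (f : ι → LocPi L) {x : ∀ i, L i}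
    (hx : x ∈ (t.inf f).carrier) {i : ι} (hi : i ∈ t) : x ∈ (f i).carrier :=
  (Finset.inf_le hi : t.inf f ≤ f i) hx

theorem inf_projHom_le {A : LocPi L} {x : ∀ i, L i} (hx : x ∈ A.carrier) :
    (A.finite' x hx).toFinset.inf (fun i => projHom L i (x i)) ≤ A := by
  intro y hy
  have hyf := finite' _ _ hy
  by_cases hbot : ∃ j, y j = ⊥
  · exact A.mem_of_eq_bot hyf hbot.choose_spec
  refine A.lower' x hx y (fun i => ?_) hyf
  by_cases hi : x i = ⊤
  · simp [hi]
  · have := mem_finset_inf _ _ hy (i := i) (by simpa using hi)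
    exact (mem_projHom.1 this).2.resolve_right hbot

end Hom

/-- If an element `C` of the localic product of Hausdorff spaces contains boxes covering the product
space but not the whole box `⊤`, then the localic product is not spatial. -/
theorem not_isSpatial_of_cover {I : Type u} {X : I → Type u} [∀ i, TopologicalSpace (X i)]
    [∀ i, T2Space (X i)] (C : LocPi fun i => Opens (X i))
    (hcover : ∀ f : ∀ i, X i, ∃ U ∈ C.carrier, ∀ i, f i ∈ U i) (htop : ⊤ ∉ C.carrier) :
    ¬ (Locale.pi fun i => omegaLocale (X i)).IsSpatial := by
  intro h
  have h' : (Locale.of (LocPi fun i => Opens (X i))).IsSpatial := h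
  obtain ⟨p, hp⟩ := h'.exists_point (a := C) fun hC => htop (hC ▸ top_mem)
  choose f hf using fun i =>
    (p.comp (projHom (fun i => Opens (X i)) i)).exists_forall_iff_mem_of_t2Space
  obtain ⟨U, hU, hfU⟩ := hcover f
  refine hp (OrderHomClass.mono p (inf_projHom_le hU) ?_)
  rw [map_finset_inf, Finset.inf_eq_iInf]
  simp only [iInf_Prop_eq]
  exact fun i _ => (hf i (U i)).2 (hfU i)

variable {I : Type v}

open Classical in
/-- The element of `⨁ i, Ω ω` consisting of the boxes through which there is no function that is
injective on a finite set of coordinates including all those with a proper side. -/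
def noInjection (I : Type v) : LocPi fun _ : I => Opens ℕ where
  carrier := {x | {i | x i ≠ ⊤}.Finite ∧ ∀ (F : Finset I) (g : I → ℕ),
    {i | x i ≠ ⊤} ⊆ F → Set.InjOn g F → ¬ ∀ i, g i ∈ x i}
  finite' := fun _ hx => hx.1
  lower' := fun x hx y hyx hy => ⟨hy, fun F g hF hg h => hx.2 F g
    (fun i hi => hF fun hi' => hi (top_unique (hi' ▸ hyx i))) hg fun i => hyx i (h i)⟩
  sSup' := by
    intro x hx i S h
    refine ⟨finite_update hx i _, fun F g hF hg hgx => ?_⟩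
    -- It may be assumed that `i ∈ F`: otherwise `g i` can be replaced by a new value.
    obtain ⟨g', hg', hgx'⟩ : ∃ g' : I → ℕ, Set.InjOn g' (insert i F : Finset I) ∧
        ∀ j, g' j ∈ Function.update x i (sSup S) j := by
      by_cases hi : i ∈ F
      · exact ⟨g, by rwa [Finset.insert_eq_of_mem hi], hgx⟩
      have hS : Function.update x i (sSup S) i = ⊤ := by
        by_contra hne
        exact hi (hF hne)
      obtain ⟨m, hm⟩ := Infinite.exists_notMem_finset (F.image g)
      refine ⟨Function.update g i m, ?_, fun j => ?_⟩
      · have heq : Set.EqOn (Function.update g i m) g F := fun j hj =>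
          Function.update_of_ne (by rintro rfl; exact hi hj) _ _
        rw [Finset.coe_insert, Set.injOn_insert (by simpa using hi)]
        refine ⟨hg.congr heq.symm, ?_⟩
        rw [heq.image_eq, Function.update_self]
        simpa using hm
      · by_cases hj : j = i
        · subst hj
          rw [hS]
          trivial
        · simpa only [Function.update_of_ne hj] using hgx j
    have hi := hgx' i
    rw [Function.update_self] at hi
    obtain ⟨s, hs, his⟩ := Opens.mem_sSup.1 hi
    refine (h s hs).2 (insert i F) g' (fun j hj => ?_) hg' fun j => ?_
    · by_cases hji : j = i
      · simp [hji]
      · have : j ∈ F := hF (by simpa [Function.update_of_ne hji] using hj)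
        simp [this]
    · by_cases hji : j = i
      · subst hji
        simpa using his
      · have := hgx' j
        rw [Function.update_of_ne hji] at this ⊢
        exact this

theorem not_isSpatial_of_uncountable {I : Type} [Uncountable I] :
    ¬ (Locale.pi fun _ : I => omegaLocale ℕ).IsSpatial := by
  classical
  refine not_isSpatial_of_cover (noInjection I) (fun f => ?_) fun h => ?_
  · obtain ⟨i, j, hf, hij⟩ : ∃ i j, f i = f j ∧ i ≠ j := by
      by_contra! h
      exact not_countable (α := I) (Function.Injective.countable fun i j hij => h i j hij)
    let n : Opens ℕ := ⟨{f i}, isOpen_discrete _⟩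
    have hn : n ≠ ⊤ := fun hn => by
      have : f i + 1 ∈ n := hn ▸ trivial
      exact Nat.succ_ne_self _ this
    refine ⟨fun k => if k = i ∨ k = j then n else ⊤, ⟨?_, fun F g hF hg hgx => hij ?_⟩, fun k => ?_⟩
    · refine (Set.toFinite {i, j}).subset fun k hk => ?_
      by_contra hk'
      exact hk (if_neg hk')
    · have hi := hgx i
      have hj := hgx j
      simp only [true_or, or_true, if_true] at hi hj
      exact hg (hF (by simpa using hn)) (hF (by simpa using hn))
        ((show g i = f i from hi).trans (show g j = f i from hj).symm)
    · dsimp only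
      split_ifs with hk
      · rcases hk with rfl | rfl
        exacts [rfl, hf.symm]
      · trivial
  · exact h.2 ∅ 0 (by simp) (by simp) fun _ => trivial

end LocPi

theorem mainTheorem8 :
    ¬ (Locale.prod (omegaLocale ℚ) (omegaLocale ℚ)).IsSpatial ∧
    ¬ (Locale.prod (omegaLocale SorgenfreyLine) (omegaLocale SorgenfreyLine)).IsSpatial ∧
    ¬ (Locale.prod (omegaLocale WFTree) (omegaLocale (ℕ → ℕ))).IsSpatial ∧
    ¬ (Locale.pi fun _ : (Ordinal.omega 1 : Ordinal.{0}).ToType => omegaLocale ℕ).IsSpatial ∧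
    (∀ (X : Type u) [TopologicalSpace X] [T2Space X] [Nonempty X] (A B : Set X),
      Disjoint A B → Dense A → Dense B →
        ¬ (Locale.prod (omegaLocale A) (omegaLocale B)).IsSpatial) := by
  refine ⟨not_isSpatial_rat_prod_rat, SorgenfreyLine.not_isSpatial_prod,
    WFTree.not_isSpatial_prod_baire, ?_, ?_⟩
  · have : Uncountable (Ordinal.omega 1 : Ordinal.{0}).ToType := by
      rw [← Cardinal.aleph0_lt_mk_iff, Cardinal.mk_toType, Ordinal.card_omega]
      exact Cardinal.aleph0_lt_aleph_one
    exact LocPi.not_isSpatial_of_uncountable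
  · intro X _ _ _ A B hAB hA hB
    exact not_isSpatial_of_isEmbedding .subtypeVal .subtypeVal hA.denseRange_val hB.denseRange_val
      fun a b => hAB.ne_of_mem a.2 b.2
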